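/- Let $G=(V,E)$ be a tree on $k\ge 1$ vertices. Choose an orientation of its edges and let $E'\subseteq V\times V$ be the resulting set of ordered pairs. Every $e=(x,y)\in E'$ acts on finite words over the alphabet $V$ by $e\cdot\emptyset=\emptyset$ and $$ e\cdot(xw)=y\,(e\cdot w),\qquad e\cdot(yw)=xw,\qquad e\cdot(zw)=zw\quad(z\in V\setminus\{x,y\}), $$ and the identity state $id$ acts trivially. (These are the states of the tree automaton of $G$; they generate its automaton group.) For $n\ge 1$ let $\Gamma_n^G$ be the $n$-th Schreier graph: its vertex set is $V^n$, the set of words of length $n$, and each $u\in V^n$ is joined to $q\cdot u$ by an edge labelled $q$, for every $q\in E'\cup\{id\}$ (loops and multiple edges are allowed). For a finite connected graph $\Gamma$ let $$ W(\Gamma)=\frac12\sum_{u,v\in V(\Gamma)}d_\Gamma(u,v) $$ be its Wiener index (the sum of the distances over all unordered pairs of vertices). Then, for every $n\ge 1$ and every choice of the orientation, $\Gamma_n^G$ is connected and $$ \begin{aligned} W(\Gamma_n^G) ={}& \frac{(k-1)^2(2k^2-2k-1)}{k^3(2k-1)}\cdot 2^n k^{2n} - \frac{2(k-1)^2}{k^2}\cdot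 n k^{2n} + \frac{2(k+1)(k-1)}{k^3}\cdot k^{2n} - \frac{2(k+1)(k-1)}{k(2k-1)}\cdot k^n\\ &+ \left(\frac{2}{k^2}\cdot n k^{2n} - \frac{k^2+2}{k^3(k-1)}\cdot k^{2n} + \frac{k+2}{k^2(k-1)}\cdot k^n\right) W(G). \end{aligned} $$ For $k=1$, where $W(G)=0$, the last summand is read as $0$. -/

import Mathlib

/-- An automaton (transducer) with state set `Q` and alphabet `X`. -/
structure Transducer (Q X : Type*) where
  /-- the restriction map `λ` -/
  restrict : Q → X → Q
  /-- the output map `η` -/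
  output : Q → X → X

namespace Transducer

variable {Q X : Type*}

/-- The action `η(q, ·)` of a state on finite words:
`η(q, x w) = η(q, x) η(λ(q, x), w)`. -/
def act (A : Transducer Q X) : Q → List X → List X
  | _, [] => []
  | q, x :: w => A.output q x :: A.act (A.restrict q x) w

theorem length_act (A : Transducer Q X) (q : Q) (w : List X) :
    (A.act q w).length = w.length := by
  induction w generalizing q with
  | nil => rfl
  | cons x w ih => simp [act, ih]

/-- The action of a state on the set `X ^ n` of words of length `n`. -/
def actWord (A : Transducer Q X) (n : ℕ) (q : Q) (w : List.Vector X n) : List.Vector X n :=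
  ⟨A.act q w.1, (A.length_act q w.1).trans w.2⟩

/-- The `n`-th Schreier graph of the action generated by the states of `A`: an undirected
multigraph with vertex set `X ^ n` and, for every state `q` and every word `u` of length `n`,
one edge (possibly a loop) labelled `q` that joins `u` and `η(q, u)`. -/
def schreierGraph (A : Transducer Q X) (n : ℕ) :
    Graph (List.Vector X n) (Q × List.Vector X n) where
  vertexSet := Set.univ
  IsLink e u v := (u = e.2 ∧ v = A.actWord n e.1 e.2) ∨ (v = e.2 ∧ u = A.actWord n e.1 e.2)
  isLink_symm _ _ := ⟨fun _ _ h => h.symm⟩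
  eq_or_eq_of_isLink_of_isLink := by
    rintro e x y v w (⟨h1, h2⟩ | ⟨h1, h2⟩) (⟨h3, h4⟩ | ⟨h3, h4⟩)
    · exact Or.inl (h1.trans h3.symm)
    · exact Or.inr (h1.trans h3.symm)
    · exact Or.inr (h2.trans h4.symm)
    · exact Or.inl (h2.trans h4.symm)
  left_mem_of_isLink := fun _ _ _ _ => Set.mem_univ _

/-- The simple graph underlying the `n`-th Schreier graph (loops are dropped and parallel edges
are merged, which does not affect distances). -/
def simpleSchreierGraph (A : Transducer Q X) (n : ℕ) : SimpleGraph (List.Vector X n) :=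
  SimpleGraph.fromRel (A.schreierGraph n).Adj

end Transducer

/-- An orientation of `G`: a set of ordered pairs that contains, for every edge `{x, y}` of `G`,
exactly one of `(x, y)` and `(y, x)`, and nothing else. -/
structure GraphOrientation {V : Type*} (G : SimpleGraph V) where
  /-- the set of oriented edges -/
  arcs : Set (V × V)
  adj_of_mem : ∀ ⦃x y⦄, (x, y) ∈ arcs → G.Adj x y
  mem_of_adj : ∀ ⦃x y⦄, G.Adj x y → Xor ((x, y) ∈ arcs) ((y, x) ∈ arcs)

/-- The automaton of an oriented graph. Its states are the oriented edges and the sink `none`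
(the identity state); its alphabet is the vertex set. -/
def graphAutomaton {V : Type*} [DecidableEq V] {G : SimpleGraph V} (o : GraphOrientation G) :
    Transducer (Option o.arcs) V where
  restrict
    | none, _ => none
    | some e, z => if z = e.1.1 then some e else none
  output
    | none, z => z
    | some e, z => if z = e.1.1 then e.1.2 else if z = e.1.2 then e.1.1 else z

/-- The Wiener index of a finite connected graph: the sum of the distances over all unordered
pairs of vertices, that is, half the sum over all ordered pairs. -/
noncomputable def wienerIndex {V : Type*} [Fintype V] (G : SimpleGraph V) : ℚ :=
  (1 / 2) * ∑ u, ∑ v, (G.dist u v : ℚ)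

/-! Words are read from the last letter. For an edge `a`, the words of length `n` in the two
endpoints of `a` form a cycle of length `2 ^ n`, the big cycle of `a`, on which `a` acts as a binary
odometer. The graph of level `n + 1` consists of one copy of level `n` per last letter. For each
edge `a`, the big cycles of `a` in the copies of its two endpoints are cut open and joined into one
cycle of double length; all other cycles survive. The graph is therefore a cactus (a cycle of length
2 being an edge), and a distance is the sum, over all cycles, of the distance between the
projections of the two words.

The projection to a big cycle is `pos`: binary digits are read while the letters are endpoints of
`a`, and the first other letter selects an end of the remaining interval according to its side of
`a` in the tree. Only the data in `EdgeSides` enter. `wordDist` is the resulting candidate for the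
distance. It changes by at most one along an edge (`wordDist_step_le`) and some move lowers it
(`exists_sees`, `Sees.exists_step`), so `connected_and_dist_eq` identifies it with the distance and
gives connectedness.

Summing over all pairs, the big cycle of `a` contributes an amount depending only on the sizes `p`,
`q` of the two sides, through `(p - 1) * (q - 1)` (`sumBig_succ`). The remaining cycles obey linear
recursions (`sumInnerTo_succ`, `sumInner_succ`). Since the sum of `p * q` over the edges is the
Wiener index of the tree, solving the recursions gives the formula. -/

namespace TreeSchreier

/-! ### Reversed words, moves along edges and positions on big cycles. -/

section Words

set_option linter.unusedSectionVars false

variable {V : Type*} [DecidableEq V]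

/-- The distance between the positions `i, j < N` on a cycle of length `N`. -/
def cyc (N i j : ℕ) : ℕ := min (i - j + (j - i)) (N - (i - j + (j - i)))

theorem cyc_self (N i : ℕ) : cyc N i i = 0 := by simp [cyc]

theorem cyc_comm (N i j : ℕ) : cyc N i j = cyc N j i := by unfold cyc; omega

/-- The transposition of two letters. -/
def swapLetter (x y z : V) : V := if z = x then y else if z = y then x else z

theorem swapLetter_of_ne {x y z : V} (hx : z ≠ x) (hy : z ≠ y) : swapLetter x y z = z := by
  simp [swapLetter, hx, hy]

/-- The action of the oriented edge `(x, y)` on reversed words, whose head is the last letter. -/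
def step (x y : V) : List V → List V
  | [] => []
  | z :: u => if u = List.replicate u.length x then
      swapLetter x y z :: List.replicate u.length y else z :: step x y u

@[simp] theorem length_step (x y : V) (u : List V) : (step x y u).length = u.length := by
  induction u with
  | nil => rfl
  | cons z u ih => simp only [step]; split_ifs <;> simp [ih]

theorem step_replicate (x y : V) (n : ℕ) :
    step x y (List.replicate n x) = List.replicate n y := by
  cases n with
  | zero => rfl
  | succ n => simp [List.replicate_succ, step, swapLetter]

theorem step_cons_of_ne {x y z : V} (hx : z ≠ x) (hy : z ≠ y) (u : List V) :
    step x y (z :: u) = z :: step x y u := by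
  by_cases h : u = List.replicate u.length x
  · rw [step, if_pos h, swapLetter_of_ne hx hy]
    conv_rhs => rw [h, step_replicate]
  · rw [step, if_neg h]

/-- All letters of the word are endpoints of the edge `a`. -/
def OnEdge (a : V × V) (u : List V) : Prop := ∀ c ∈ u, c = a.1 ∨ c = a.2

theorem onEdge_cons {a : V × V} {z : V} {u : List V} :
    OnEdge a (z :: u) ↔ (z = a.1 ∨ z = a.2) ∧ OnEdge a u := by
  simp [OnEdge]

theorem onEdge_replicate {a : V × V} {x : V} (n : ℕ) (h : x = a.1 ∨ x = a.2) :
    OnEdge a (List.replicate n x) := fun c hc => by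
  rw [List.eq_of_mem_replicate hc]; exact h

/-- `x` and `y` are the endpoints of `a`, in one of the two orders. -/
def Ends (a : V × V) (x y : V) : Prop := (x = a.1 ∧ y = a.2) ∨ (x = a.2 ∧ y = a.1)

/-- The head can change only if the carry runs through all of `u`, that is, if `u` is constantly
`x`. Then `z` is not an endpoint of `a`, and such a letter stops the carry unchanged. -/
theorem step_cons_of_not_onEdge {a : V × V} {x y z : V} {u : List V} (h : Ends a x y)
    (hu : ¬ OnEdge a (z :: u)) : step x y (z :: u) = z :: step x y u := by
  by_cases hz : z = a.1 ∨ z = a.2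
  · have hu' : u ≠ List.replicate u.length x := by
      intro he
      refine hu (onEdge_cons.2 ⟨hz, ?_⟩)
      rw [he]
      exact onEdge_replicate _ (h.imp And.left And.left)
    rw [step, if_neg hu']
  · push Not at hz
    rcases h with ⟨rfl, rfl⟩ | ⟨rfl, rfl⟩
    · exact step_cons_of_ne hz.1 hz.2 u
    · exact step_cons_of_ne hz.2 hz.1 u

/-- The position, on the cycle formed by the words in the endpoints of the edge `a`, of the
projection of a reversed word. -/
def pos (side : V × V → V → Bool) (a : V × V) : List V → ℕ
  | [] => 0
  | z :: u => if z = a.1 then pos side a u else if z = a.2 then pos side a u + 2 ^ u.length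
      else if side a z then 2 ^ (u.length + 1) - 1 else 0

/-- The properties of the two sides of the edges of a tree that determine distances:
`side a z` tells whether `z` lies on the side of `a.2` of the edge `a`. -/
structure EdgeSides (A : Finset (V × V)) (side : V × V → V → Bool) : Prop where
  fst : ∀ a ∈ A, side a a.1 = false
  snd : ∀ a ∈ A, side a a.2 = true
  other : ∀ a ∈ A, ∀ b ∈ A, a ≠ b → side a b.1 = side a b.2
  sep : ∀ x z, x ≠ z → ∃ a ∈ A, (a.1 = x ∨ a.2 = x) ∧ side a x ≠ side a z

variable {A : Finset (V × V)} {side : V × V → V → Bool}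

theorem EdgeSides.ne (h : EdgeSides A side) {a : V × V} (ha : a ∈ A) : a.1 ≠ a.2 := fun e => by
  have h1 := h.fst a ha
  have h2 := h.snd a ha
  rw [e, h2] at h1
  cases h1

theorem EdgeSides.other' (h : EdgeSides A side) {a b : V × V} (ha : a ∈ A) (hb : b ∈ A)
    (hab : b ≠ a) {x y : V} (hx : Ends a x y) : side b x = side b y := by
  rcases hx with ⟨rfl, rfl⟩ | ⟨rfl, rfl⟩
  · exact h.other b hb a ha hab
  · exact (h.other b hb a ha hab).symm

theorem Ends.ne (h : EdgeSides A side) {a : V × V} (ha : a ∈ A) {x y : V} (hx : Ends a x y) :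
    x ≠ y := by
  rcases hx with ⟨rfl, rfl⟩ | ⟨rfl, rfl⟩
  · exact h.ne ha
  · exact (h.ne ha).symm

theorem pos_lt (a : V × V) (u : List V) : pos side a u < 2 ^ u.length := by
  induction u with
  | nil => simp [pos]
  | cons z u ih =>
    have h0 : 0 < 2 ^ u.length := by positivity
    simp only [pos, List.length_cons, pow_succ]
    split_ifs <;> omega

theorem pos_eq_zero (h : EdgeSides A side) {a : V × V} (ha : a ∈ A) {u : List V}
    (hu : ∀ c ∈ u, side a c = false) : pos side a u = 0 := by
  induction u with
  | nil => rfl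
  | cons z u ih =>
    have hz := hu z (by simp)
    have h2 : z ≠ a.2 := fun e => by rw [e, h.snd a ha] at hz; cases hz
    simp [pos, h2, hz, ih (fun c hc => hu c (by simp [hc]))]

theorem pos_eq_top (h : EdgeSides A side) {a : V × V} (ha : a ∈ A) {u : List V}
    (hu : ∀ c ∈ u, side a c = true) : pos side a u = 2 ^ u.length - 1 := by
  induction u with
  | nil => rfl
  | cons z u ih =>
    have hz := hu z (by simp)
    have h2 : z ≠ a.1 := fun e => by rw [e, h.fst a ha] at hz; cases hz
    have h0 : 0 < 2 ^ u.length := by positivity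
    simp only [pos, h2, if_false, hz, ih (fun c hc => hu c (by simp [hc])), List.length_cons, pow_succ]
    generalize 2 ^ u.length = N at *
    split_ifs <;> omega

/-- The position of a word all of whose letters are on the same side of the edge. -/
theorem pos_of_side (h : EdgeSides A side) {a : V × V} (ha : a ∈ A) {u : List V} {s : Bool}
    (hu : ∀ c ∈ u, side a c = s) : pos side a u = if s then 2 ^ u.length - 1 else 0 := by
  cases s
  · simpa using pos_eq_zero h ha hu
  · simpa using pos_eq_top h ha hu

theorem pos_replicate (h : EdgeSides A side) {a : V × V} (ha : a ∈ A) (n : ℕ) (x : V) :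
    pos side a (List.replicate n x) = if side a x then 2 ^ n - 1 else 0 := by
  simpa using pos_of_side h ha (u := List.replicate n x) (s := side a x)
    (fun c hc => by rw [List.eq_of_mem_replicate hc])

/-- Moving along an edge does not change the projection to the cycle of another edge. -/
theorem pos_step_of_side_eq (h : EdgeSides A side) {a : V × V} (ha : a ∈ A) {x y : V}
    (hxy : side a x = side a y) (u : List V) : pos side a (step x y u) = pos side a u := by
  induction u with
  | nil => rfl
  | cons z u ih =>
    by_cases hu : u = List.replicate u.length x
    · rw [step, if_pos hu]
      -- If `z` is `x` or `y`, all letters before and after the move lie on the side of `x`.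
      -- Otherwise `z` stays and only a constant tail is replaced, by one on the same side.
      by_cases hz : z = x ∨ z = y
      · have hs : ∀ c ∈ swapLetter x y z :: List.replicate u.length y, side a c = side a x := by
          intro c hc
          rcases List.mem_cons.1 hc with rfl | hc
          · unfold swapLetter
            split_ifs with h1 h2
            exacts [hxy.symm, rfl, absurd hz (by tauto)]
          · rw [List.eq_of_mem_replicate hc, hxy]
        have hs' : ∀ c ∈ z :: u, side a c = side a x := by
          intro c hc
          rcases List.mem_cons.1 hc with rfl | hc
          · rcases hz with rfl | rfl
            · rfl
            · exact hxy.symm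
          · rw [hu] at hc; rw [List.eq_of_mem_replicate hc]
        rw [pos_of_side h ha hs, pos_of_side h ha hs']
        simp
      · push Not at hz
        rw [swapLetter_of_ne hz.1 hz.2]
        have e : pos side a (List.replicate u.length y) = pos side a u := by
          conv_rhs => rw [hu]
          rw [pos_replicate h ha, pos_replicate h ha, hxy]
        simp only [pos, e, List.length_replicate]
    · rw [step, if_neg hu]
      simp [pos, ih]

/-- Off the cycles of an edge `a`, a move along `a` does not change the projection to the
big cycle of `a`. -/
theorem pos_step_of_not_onEdge {a : V × V} {x y : V} (hx : Ends a x y) {u : List V}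
    (hu : ¬ OnEdge a u) : pos side a (step x y u) = pos side a u := by
  induction u with
  | nil => rfl
  | cons z u ih =>
    rw [step_cons_of_not_onEdge hx hu]
    by_cases hz : z = a.1 ∨ z = a.2
    · have : ¬ OnEdge a u := fun h' => hu (onEdge_cons.2 ⟨hz, h'⟩)
      simp [pos, ih this]
    · push Not at hz
      simp [pos, hz]

/-- On words in the endpoints of `a`, `pos` is a binary numeral with digits `a.1 = 0`, `a.2 = 1` and
the head most significant. -/
theorem eq_replicate_of_pos_eq_zero {a : V × V} {u : List V} (hu : OnEdge a u)
    (hp : pos side a u = 0) : u = List.replicate u.length a.1 := by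
  induction u with
  | nil => rfl
  | cons z u ih =>
    rw [onEdge_cons] at hu
    have h0 : 0 < 2 ^ u.length := by positivity
    have hz : z = a.1 := by
      by_contra hne
      rw [pos, if_neg hne, if_pos (hu.1.resolve_left hne)] at hp
      omega
    rw [pos, if_pos hz] at hp
    rw [List.length_cons, List.replicate_succ, ← ih hu.2 hp, hz]

theorem eq_replicate_of_pos_eq_top {a : V × V} {u : List V} (hu : OnEdge a u)
    (hp : pos side a u + 1 = 2 ^ u.length) : u = List.replicate u.length a.2 := by
  induction u with
  | nil => rfl
  | cons z u ih =>
    rw [onEdge_cons] at hu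
    have h0 : 0 < 2 ^ u.length := by positivity
    have h1 := pos_lt (side := side) a u
    rw [List.length_cons, pow_succ] at hp
    have hz : z ≠ a.1 := by
      intro e
      rw [pos, if_pos e] at hp
      omega
    have hz' := hu.1.resolve_left hz
    rw [pos, if_neg hz, if_pos hz'] at hp
    rw [List.length_cons, List.replicate_succ, ← ih hu.2 (by omega), hz']

/-- The edge `a` moves its big cycle one position downwards. -/
theorem pos_step_down (h : EdgeSides A side) {a : V × V} (ha : a ∈ A) {u : List V}
    (hu : OnEdge a u) : pos side a (step a.1 a.2 u) =
      if pos side a u = 0 then 2 ^ u.length - 1 else pos side a u - 1 := by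
  induction u with
  | nil => rfl
  | cons z u ih =>
    have hne := h.ne ha
    have h0 : 0 < 2 ^ u.length := by positivity
    have h1 := pos_lt (side := side) a u
    rw [onEdge_cons] at hu
    by_cases hc : u = List.replicate u.length a.1
    · have p0 : pos side a u = 0 := by rw [hc, pos_replicate h ha, h.fst a ha]; rfl
      rw [step, if_pos hc]
      rcases hu.1 with rfl | rfl
      · simp only [swapLetter, pos, if_true, if_neg hne.symm, pos_replicate h ha, h.snd a ha, p0,
          List.length_replicate, List.length_cons, pow_succ]
        omega
      · simp only [swapLetter, pos, if_true, if_neg hne.symm, pos_replicate h ha, h.snd a ha, p0,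
          List.length_cons]
        rw [if_neg (by omega)]
        omega
    · have p0 : pos side a u ≠ 0 := fun e => hc (eq_replicate_of_pos_eq_zero hu.2 e)
      rw [step, if_neg hc]
      have ih' := ih hu.2
      rw [if_neg p0] at ih'
      rcases hu.1 with rfl | rfl
      · simp only [pos, if_true, ih', if_neg p0]
      · simp only [pos, if_true, if_neg hne.symm, ih', length_step]
        rw [if_neg (by omega)]
        omega

/-- The reversed edge moves the big cycle one position upwards. -/
theorem pos_step_up (h : EdgeSides A side) {a : V × V} (ha : a ∈ A) {u : List V}
    (hu : OnEdge a u) : pos side a (step a.2 a.1 u) =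
      if pos side a u + 1 = 2 ^ u.length then 0 else pos side a u + 1 := by
  induction u with
  | nil => rfl
  | cons z u ih =>
    have hne := h.ne ha
    have h0 : 0 < 2 ^ u.length := by positivity
    have h1 := pos_lt (side := side) a u
    rw [onEdge_cons] at hu
    by_cases hc : u = List.replicate u.length a.2
    · have p0 : pos side a u = 2 ^ u.length - 1 := by
        conv_lhs => rw [hc, pos_replicate h ha, h.snd a ha]
        rfl
      rw [step, if_pos hc]
      rcases hu.1 with rfl | rfl
      · simp only [swapLetter, pos, if_true, if_neg hne, if_neg hne.symm, pos_replicate h ha,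
          h.fst a ha, p0, List.length_replicate, List.length_cons, pow_succ]
        generalize 2 ^ u.length = N at *
        simp only [Bool.false_eq_true, if_false]
        split_ifs <;> omega
      · simp only [swapLetter, pos, if_true, if_neg hne.symm, pos_replicate h ha, h.fst a ha, p0,
          List.length_cons, pow_succ]
        generalize 2 ^ u.length = N at *
        simp only [Bool.false_eq_true, if_false]
        split_ifs <;> omega
    · have p0 : pos side a u + 1 ≠ 2 ^ u.length := fun e => hc (eq_replicate_of_pos_eq_top hu.2 e)
      rw [step, if_neg hc]
      have ih' := ih hu.2
      rw [if_neg p0] at ih'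
      rcases hu.1 with rfl | rfl
      · simp only [pos, if_true, ih', List.length_cons, pow_succ]
        rw [if_neg (by omega)]
      · simp only [pos, if_true, if_neg hne.symm, ih', length_step, List.length_cons, pow_succ]
        rw [if_neg (by omega)]
        omega

theorem cyc_pos_step_le (h : EdgeSides A side) {a : V × V} (ha : a ∈ A) {x y : V}
    (hx : Ends a x y) {u : List V} (hu : OnEdge a u) {j : ℕ} (hj : j < 2 ^ u.length) :
    cyc (2 ^ u.length) (pos side a (step x y u)) j ≤
      cyc (2 ^ u.length) (pos side a u) j + 1 := by
  have h1 := pos_lt (side := side) a u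
  rcases hx with ⟨rfl, rfl⟩ | ⟨rfl, rfl⟩
  · rw [pos_step_down h ha hu]
    unfold cyc
    split_ifs <;> omega
  · rw [pos_step_up h ha hu]
    unfold cyc
    split_ifs <;> omega

theorem exists_cyc_pos_step_lt (h : EdgeSides A side) {a : V × V} (ha : a ∈ A)
    {u : List V} (hu : OnEdge a u) {j : ℕ} (hj : j < 2 ^ u.length) (hne : j ≠ pos side a u) :
    ∃ x y, Ends a x y ∧ cyc (2 ^ u.length) (pos side a (step x y u)) j <
      cyc (2 ^ u.length) (pos side a u) j := by
  have h1 := pos_lt (side := side) a u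
  by_cases hlt : cyc (2 ^ u.length) (pos side a (step a.1 a.2 u)) j <
      cyc (2 ^ u.length) (pos side a u) j
  · exact ⟨_, _, Or.inl ⟨rfl, rfl⟩, hlt⟩
  · refine ⟨_, _, Or.inr ⟨rfl, rfl⟩, ?_⟩
    rw [pos_step_down h ha hu] at hlt
    rw [pos_step_up h ha hu]
    have he : 2 ^ u.length % 2 = 0 ∨ 2 ^ u.length = 1 := by
      cases u.length with
      | zero => simp
      | succ n => left; simp [pow_succ]
    unfold cyc at hlt ⊢
    split_ifs at hlt ⊢ <;> omega

end Words

end TreeSchreier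

namespace TreeSchreier

/-! ### The candidate distance as a sum over cycles, and its behaviour under moves. -/

section Distance

set_option linter.unusedSectionVars false

variable {V : Type*} [DecidableEq V]

/-- The projection to the copy of the previous Schreier graph formed by the words with last
letter `z`. -/
def restr (z : V) : List V → List V
  | [] => []
  | c :: u => if c = z then u else List.replicate u.length z

theorem length_restr {z : V} {u : List V} {n : ℕ} (hu : u.length = n + 1) :
    (restr z u).length = n := by
  cases u with
  | nil => simp at hu
  | cons c u => simp only [restr]; split_ifs <;> simp_all

theorem restr_replicate (z x : V) (n : ℕ) :
    restr z (List.replicate (n + 1) x) = List.replicate n z := by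
  rw [List.replicate_succ, restr]
  split_ifs with h <;> simp [h]

theorem restr_cons_replicate (z c x : V) (n : ℕ) :
    restr z (c :: List.replicate n x) = List.replicate n (if c = z then x else z) := by
  rw [restr]
  split_ifs <;> simp

/-- The distance between the projections of two words to the big cycle of the edge `a`. -/
def big (side : V × V → V → Bool) (n : ℕ) (a : V × V) (u w : List V) : ℕ :=
  cyc (2 ^ n) (pos side a u) (pos side a w)

variable [Fintype V]

/-- The contribution to the distance of the cycles other than the big ones. -/
def inner (A : Finset (V × V)) (side : V × V → V → Bool) : ℕ → List V → List V → ℕ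
  | 0, _, _ => 0
  | n + 1, u, w => ∑ z, (inner A side n (restr z u) (restr z w) +
      ∑ a ∈ A with z ≠ a.1 ∧ z ≠ a.2, big side n a (restr z u) (restr z w))

/-- The contribution to the distance of the cycles other than the big ones of edges at `z`. -/
def innerAvoid (A : Finset (V × V)) (side : V × V → V → Bool) (z : V) (n : ℕ) (u w : List V) : ℕ :=
  inner A side n u w + ∑ a ∈ A with z ≠ a.1 ∧ z ≠ a.2, big side n a u w

/-- The distance between two reversed words in the Schreier graph. -/
def wordDist (A : Finset (V × V)) (side : V × V → V → Bool) (n : ℕ) (u w : List V) : ℕ :=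
  inner A side n u w + ∑ a ∈ A, big side n a u w

variable {A : Finset (V × V)} {side : V × V → V → Bool}

theorem inner_succ (n : ℕ) (u w : List V) :
    inner A side (n + 1) u w = ∑ z, innerAvoid A side z n (restr z u) (restr z w) := rfl

/-- In the copy of each letter `z`, every constant word projects to the same vertex, the word
constantly `z`. -/
theorem inner_replicate (n : ℕ) (x y : V) (w : List V) :
    inner A side n (List.replicate n x) w = inner A side n (List.replicate n y) w := by
  cases n with
  | zero => rfl
  | succ n => simp only [inner_succ, restr_replicate]

theorem innerAvoid_congr {a : V × V} {z : V} {n : ℕ} {u u' : List V} (w : List V)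
    (hz : z = a.1 ∨ z = a.2) (hi : inner A side n u w = inner A side n u' w)
    (hp : ∀ b ∈ A, b ≠ a → pos side b u = pos side b u') :
    innerAvoid A side z n u w = innerAvoid A side z n u' w := by
  unfold innerAvoid
  rw [hi]
  congr 1
  refine Finset.sum_congr rfl fun b hb => ?_
  rw [Finset.mem_filter] at hb
  have hba : b ≠ a := by
    rintro rfl
    rcases hz with e | e
    · exact hb.2.1 e
    · exact hb.2.2 e
  rw [big, big, hp b hb.1 hba]

theorem innerAvoid_replicate (h : EdgeSides A side) {a : V × V} (ha : a ∈ A) {x y z : V}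
    (hz : z = a.1 ∨ z = a.2) (hx : x = a.1 ∨ x = a.2) (hy : y = a.1 ∨ y = a.2) (n : ℕ)
    (w : List V) : innerAvoid A side z n (List.replicate n x) w =
      innerAvoid A side z n (List.replicate n y) w := by
  refine innerAvoid_congr w hz (inner_replicate n x y w) fun b hb hba => ?_
  have := h.other b hb a ha hba
  have : side b x = side b y := by
    rcases hx with rfl | rfl <;> rcases hy with rfl | rfl <;> simp [this]
  rw [pos_replicate h hb, pos_replicate h hb, this]

/-- A move along the big cycle of `a` leaves every other cycle's projection fixed. The pieces of
that big cycle inside the copies of the endpoints of `a` are excluded from `innerAvoid`, so nothing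
in `inner` changes. -/
theorem inner_step_of_onEdge (h : EdgeSides A side) {a : V × V} (ha : a ∈ A) {x y : V}
    (hx : Ends a x y) {n : ℕ} {u : List V} (hl : u.length = n) (hu : OnEdge a u) (w : List V) :
    inner A side n (step x y u) w = inner A side n u w := by
  have hxa : x = a.1 ∨ x = a.2 := hx.imp And.left And.left
  have hya : y = a.1 ∨ y = a.2 := (hx.imp And.right And.right).symm
  induction n generalizing u w with
  | zero => rfl
  | succ n ih =>
    obtain ⟨c, u, rfl⟩ := List.exists_cons_of_length_eq_add_one hl
    have hl' : u.length = n := by simpa using hl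
    rw [onEdge_cons] at hu
    rw [inner_succ, inner_succ]
    refine Finset.sum_congr rfl fun z _ => ?_
    by_cases hc : u = List.replicate u.length x
    -- Here the carry reaches the head. Both words project to constant words in the copy of `z`:
    -- with letters in `a` if `z` is an endpoint of `a`, and constantly `z` otherwise.
    · rw [step, if_pos hc]
      conv_rhs => rw [hc]
      rw [hl', restr_cons_replicate, restr_cons_replicate]
      have hs : swapLetter x y c = a.1 ∨ swapLetter x y c = a.2 := by
        unfold swapLetter
        split_ifs
        exacts [hya, hxa, hu.1]
      by_cases hz : z = a.1 ∨ z = a.2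
      · exact innerAvoid_replicate h ha hz (by split_ifs <;> assumption)
          (by split_ifs <;> assumption) _ _
      · rw [if_neg (fun e : swapLetter x y c = z => hz (e ▸ hs)),
          if_neg (fun e : c = z => hz (e ▸ hu.1))]
    · rw [step, if_neg hc]
      simp only [restr, length_step]
      split_ifs with hz
      · subst hz
        exact innerAvoid_congr _ hu.1 (ih hl' hu.2 _)
          fun b hb hba => pos_step_of_side_eq h hb (h.other' ha hb hba hx) _
      · rfl

theorem wordDist_step_of_onEdge (h : EdgeSides A side) {a : V × V} (ha : a ∈ A) {x y : V}
    (hx : Ends a x y) {n : ℕ} {u : List V} (hl : u.length = n) (hu : OnEdge a u) (w : List V) :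
    wordDist A side n (step x y u) w + big side n a u w =
      wordDist A side n u w + big side n a (step x y u) w := by
  unfold wordDist
  rw [inner_step_of_onEdge h ha hx hl hu, ← Finset.add_sum_erase A _ ha,
    ← Finset.add_sum_erase A (fun b => big side n b u w) ha]
  have : ∑ b ∈ A.erase a, big side n b (step x y u) w = ∑ b ∈ A.erase a, big side n b u w := by
    refine Finset.sum_congr rfl fun b hb => ?_
    rw [Finset.mem_erase] at hb
    rw [big, big, pos_step_of_side_eq h hb.2 (h.other' ha hb.2 hb.1 hx)]
  rw [this]
  ring

/-- Off the big cycle of `a`, a move takes place inside the copy of `z`, so the two levels change by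
the same amount; the identity is written additively to avoid subtraction in `ℕ`. -/
theorem wordDist_step_cons (h : EdgeSides A side) {a : V × V} (ha : a ∈ A) {x y : V}
    (hx : Ends a x y) (n : ℕ) {z : V} {u : List V} (hu : ¬ OnEdge a (z :: u)) (w : List V) :
    wordDist A side (n + 1) (step x y (z :: u)) w + wordDist A side n u (restr z w) =
      wordDist A side (n + 1) (z :: u) w + wordDist A side n (step x y u) (restr z w) := by
  have hpos : ∀ b ∈ A, pos side b (step x y (z :: u)) = pos side b (z :: u) := by
    intro b hb
    by_cases hba : b = a
    · subst hba
      exact pos_step_of_not_onEdge hx hu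
    · exact pos_step_of_side_eq h hb (h.other' ha hb hba hx) _
  have hbig : ∑ b ∈ A, big side (n + 1) b (step x y (z :: u)) w =
      ∑ b ∈ A, big side (n + 1) b (z :: u) w :=
    Finset.sum_congr rfl fun b hb => by rw [big, big, hpos b hb]
  -- The big cycles of edges at `z` count in `wordDist` at level `n` but are cut open at level `n +
  -- 1`. The move does not affect their positions, so the discrepancy cancels.
  have hnot : ∑ b ∈ A with ¬ (z ≠ b.1 ∧ z ≠ b.2), big side n b (step x y u) (restr z w) =
      ∑ b ∈ A with ¬ (z ≠ b.1 ∧ z ≠ b.2), big side n b u (restr z w) := by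
    refine Finset.sum_congr rfl fun b hb => ?_
    rw [Finset.mem_filter] at hb
    rw [big, big]
    by_cases hba : b = a
    · subst hba
      rw [pos_step_of_not_onEdge hx fun h' => hu (onEdge_cons.2 ⟨by tauto, h'⟩)]
    · rw [pos_step_of_side_eq h hb.1 (h.other' ha hb.1 hba hx)]
  have hin : inner A side (n + 1) (step x y (z :: u)) w + innerAvoid A side z n u (restr z w) =
      inner A side (n + 1) (z :: u) w + innerAvoid A side z n (step x y u) (restr z w) := by
    rw [step_cons_of_not_onEdge hx hu, inner_succ, inner_succ,
      ← Finset.add_sum_erase _ _ (Finset.mem_univ z),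
      ← Finset.add_sum_erase _ (fun c => innerAvoid A side c n (restr c (z :: u)) (restr c w))
        (Finset.mem_univ z)]
    have : ∑ c ∈ Finset.univ.erase z, innerAvoid A side c n (restr c (z :: step x y u)) (restr c w)
        = ∑ c ∈ Finset.univ.erase z, innerAvoid A side c n (restr c (z :: u)) (restr c w) := by
      refine Finset.sum_congr rfl fun c hc => ?_
      have hc' : z ≠ c := (Finset.ne_of_mem_erase hc).symm
      simp [restr, hc']
    rw [this]
    simp only [restr, if_true]
    ring
  unfold wordDist
  rw [hbig, ← Finset.sum_filter_add_sum_filter_not A (fun b => z ≠ b.1 ∧ z ≠ b.2)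
    (fun b => big side n b u (restr z w)),
    ← Finset.sum_filter_add_sum_filter_not A (fun b => z ≠ b.1 ∧ z ≠ b.2)
    (fun b => big side n b (step x y u) (restr z w)), hnot]
  unfold innerAvoid at hin
  omega

theorem wordDist_step_le (h : EdgeSides A side) {a : V × V} (ha : a ∈ A) {x y : V}
    (hx : Ends a x y) {n : ℕ} {u w : List V} (hu : u.length = n) (hw : w.length = n) :
    wordDist A side n (step x y u) w ≤ wordDist A side n u w + 1 := by
  induction n generalizing u w with
  | zero =>
    obtain rfl := List.length_eq_zero_iff.1 hu
    exact Nat.le_succ _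
  | succ n ih =>
    by_cases ho : OnEdge a u
    · have h1 := wordDist_step_of_onEdge h ha hx hu ho w
      have h2 := cyc_pos_step_le h ha hx ho (j := pos side a w)
        (by rw [hu, ← hw]; exact pos_lt a w)
      rw [hu] at h2
      unfold big at h1
      omega
    · obtain ⟨z, u, rfl⟩ := List.exists_cons_of_length_eq_add_one hu
      have h1 := wordDist_step_cons h ha hx n ho w
      have h2 := ih (u := u) (w := restr z w) (by simpa using hu) (length_restr hw)
      omega

/-- The projection of the second word to the cycle of the edge `a` through the first word is not
the first word. -/
def Sees (side : V × V → V → Bool) (a : V × V) : List V → List V → Prop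
  | [], _ => False
  | z :: u, w => (OnEdge a (z :: u) ∧ pos side a w ≠ pos side a (z :: u)) ∨
      (¬ OnEdge a (z :: u) ∧ Sees side a u (restr z w))

/-- On the cycle of `a` through `u`, one of the two directions leads towards the projection of `w`.
`wordDist_step_cons` carries the gain up from the copy that contains this cycle. -/
theorem Sees.exists_step (h : EdgeSides A side) {a : V × V} (ha : a ∈ A) {n : ℕ} {u w : List V}
    (hu : u.length = n) (hw : w.length = n) (hs : Sees side a u w) :
    ∃ x y, Ends a x y ∧ wordDist A side n (step x y u) w < wordDist A side n u w := by
  induction n generalizing u w with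
  | zero =>
    obtain rfl := List.length_eq_zero_iff.1 hu
    exact hs.elim
  | succ n ih =>
    obtain ⟨z, u, rfl⟩ := List.exists_cons_of_length_eq_add_one hu
    rcases hs with ⟨ho, hp⟩ | ⟨ho, hs⟩
    · obtain ⟨x, y, hx, hlt⟩ := exists_cyc_pos_step_lt h ha ho
        (by rw [hu, ← hw]; exact pos_lt a w) hp
      refine ⟨x, y, hx, ?_⟩
      have h1 := wordDist_step_of_onEdge h ha hx hu ho w
      rw [hu] at hlt
      unfold big at h1
      omega
    · obtain ⟨x, y, hx, hlt⟩ := ih (u := u) (by simpa using hu) (length_restr hw) hs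
      refine ⟨x, y, hx, ?_⟩
      have h1 := wordDist_step_cons h ha hx n ho w
      omega

/-- After removal of the common last letters `x`, the next letter `c` of `w` differs from `x`. An
edge at `x` separating `x` from `c` works: the constant word sits at one end of its cycle, while `c`
puts `w` in the other half or at the other end. -/
theorem exists_pos_ne_replicate (h : EdgeSides A side) (x : V) {n : ℕ} {w : List V}
    (hw : w.length = n) (hne : w ≠ List.replicate n x) :
    ∃ a ∈ A, (a.1 = x ∨ a.2 = x) ∧ pos side a w ≠ pos side a (List.replicate n x) := by
  induction n generalizing w with
  | zero => exact absurd (by simpa using hw) hne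
  | succ n ih =>
    obtain ⟨c, w, rfl⟩ := List.exists_cons_of_length_eq_add_one hw
    have hw' : w.length = n := by simpa using hw
    by_cases hc : x = c
    · subst hc
      obtain ⟨a, ha, hx, hp⟩ := ih hw' fun e => hne (by rw [e, List.replicate_succ])
      refine ⟨a, ha, hx, ?_⟩
      rw [List.replicate_succ, pos, pos, hw', List.length_replicate]
      split_ifs
      · exact hp
      · omega
      · tauto
      · tauto
    · obtain ⟨a, ha, hx, hp⟩ := h.sep x c hc
      refine ⟨a, ha, hx, ?_⟩
      have h0 : 0 < 2 ^ n := by positivity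
      have h1 := pos_lt (side := side) a w
      have hn := h.ne ha
      rw [hw'] at h1
      rw [pos_replicate h ha, pos, hw', pow_succ]
      rcases hx with rfl | rfl
      · rw [h.fst a ha] at hp ⊢
        have : side a c = true := Bool.eq_true_of_not_eq_false (Ne.symm hp)
        rw [if_neg (Ne.symm hc), this]
        simp only [Bool.false_eq_true, if_false, if_true]
        split_ifs <;> omega
      · rw [h.snd a ha] at hp ⊢
        have : side a c = false := Bool.eq_false_of_not_eq_true (Ne.symm hp)
        rw [if_neg (Ne.symm hc), this]
        simp only [Bool.false_eq_true, if_false, if_true]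
        split_ifs <;> omega

/-- If `z :: u` is constant, it lies on the big cycles of all edges at `z`, and one of them
distinguishes `w`. Otherwise `u` differs from the projection of `w` to the copy of `z`, and a cycle
found there either survives or becomes part of a big cycle. -/
theorem exists_sees (h : EdgeSides A side) {n : ℕ} {u w : List V}
    (hu : u.length = n) (hw : w.length = n) (hne : u ≠ w) : ∃ a ∈ A, Sees side a u w := by
  induction n generalizing u w with
  | zero =>
    rw [List.length_eq_zero_iff] at hu hw
    exact absurd (hu.trans hw.symm) hne
  | succ n ih =>
    obtain ⟨z, u, rfl⟩ := List.exists_cons_of_length_eq_add_one hu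
    have hu' : u.length = n := by simpa using hu
    by_cases hc : u = List.replicate n z
    · have hc' : z :: u = List.replicate (n + 1) z := by rw [List.replicate_succ, ← hc]
      obtain ⟨a, ha, hz, hp⟩ := exists_pos_ne_replicate h z hw fun e => hne (hc'.trans e.symm)
      refine ⟨a, ha, Or.inl ⟨?_, by rwa [hc']⟩⟩
      rw [hc']
      exact onEdge_replicate _ (hz.imp Eq.symm Eq.symm)
    · obtain ⟨c, w, rfl⟩ := List.exists_cons_of_length_eq_add_one hw
      have hw' : w.length = n := by simpa using hw
      have hr : u ≠ restr z (c :: w) := by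
        intro e
        rw [restr] at e
        split_ifs at e with hcz
        · exact hne (by rw [e, hcz])
        · exact hc (by rw [e, hw'])
      obtain ⟨a, ha, hs⟩ := ih hu' (length_restr hw) hr
      refine ⟨a, ha, ?_⟩
      by_cases ho : OnEdge a (z :: u)
      · refine Or.inl ⟨ho, fun hp => ?_⟩
        have hnn := h.ne ha
        have ho' := onEdge_cons.1 ho
        have h1 := pos_lt (side := side) a w
        have h2 := pos_lt (side := side) a u
        have h3 := pos_lt (side := side) a (z :: u)
        have hs' : pos side a (restr z (c :: w)) ≠ pos side a u := by
          cases u with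
          | nil => exact hs.elim
          | cons d u => exact (hs.resolve_right fun h' => h'.1 ho'.2).2
        -- A letter outside `a` would put `w` at an end of the big cycle; equal positions would then
        -- make `z :: u` constant, against `hc`.
        have hcE : c = a.1 ∨ c = a.2 := by
          by_contra hcE
          push Not at hcE
          have hz : ∀ e, z :: u ≠ List.replicate (z :: u).length e := by
            intro e he
            rw [List.length_cons, List.replicate_succ, List.cons.injEq] at he
            exact hc (by rw [he.1, ← hu']; exact he.2)
          rw [pos, if_neg hcE.1, if_neg hcE.2] at hp
          split_ifs at hp with hsd
          · refine hz _ (eq_replicate_of_pos_eq_top (side := side) ho ?_)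
            rw [← hp, hu, hw']
            have : 0 < 2 ^ (n + 1) := by positivity
            omega
          · exact hz _ (eq_replicate_of_pos_eq_zero ho hp.symm)
        rw [hw'] at h1
        rw [hu'] at h2
        rw [restr] at hs'
        rw [pos, pos, hw', hu'] at hp
        -- Equal heads reduce to the positions of the tails, which differ; different heads lie in
        -- different halves of the cycle.
        rcases hcE with rfl | rfl <;> rcases ho'.1 with rfl | rfl
        · simp only [if_true] at hp hs'
          exact hs' hp
        · simp only [if_true, if_neg hnn.symm] at hp
          omega
        · simp only [if_true, if_neg hnn.symm] at hp
          omega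
        · simp only [if_true, if_neg hnn.symm] at hp hs'
          omega
      · exact Or.inr ⟨ho, hs⟩

theorem inner_self (n : ℕ) (u : List V) : inner A side n u u = 0 := by
  induction n generalizing u with
  | zero => rfl
  | succ n ih => simp [inner_succ, innerAvoid, ih, big, cyc_self]

theorem wordDist_self (n : ℕ) (u : List V) : wordDist A side n u u = 0 := by
  simp [wordDist, inner_self, big, cyc_self]

theorem inner_comm (n : ℕ) (u w : List V) : inner A side n u w = inner A side n w u := by
  induction n generalizing u w with
  | zero => rfl
  | succ n ih =>
    simp only [inner_succ, innerAvoid, big]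
    refine Finset.sum_congr rfl fun z _ => ?_
    rw [ih]
    simp only [cyc_comm]

end Distance

/-- A function that vanishes on the diagonal, changes by at most one along edges and can be
decreased along some edge is the distance. -/
theorem connected_and_dist_eq {W : Type*} [Nonempty W] (G : SimpleGraph W) (D : W → W → ℕ)
    (h0 : ∀ v, D v v = 0) (h1 : ∀ u u' v, G.Adj u u' → D u v ≤ D u' v + 1)
    (h2 : ∀ u v, u ≠ v → ∃ u', G.Adj u u' ∧ D u' v < D u v) :
    G.Connected ∧ ∀ u v, G.dist u v = D u v := by
  -- Descending along moves that lower `D` reaches `v` in at most `D u v` steps; the induction is on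
  -- a bound for this value.
  have hex : ∀ m, ∀ u v, D u v ≤ m → ∃ p : G.Walk u v, p.length ≤ D u v := by
    intro m
    induction m with
    | zero =>
      intro u v hm
      by_cases huv : u = v
      · subst huv; exact ⟨.nil, by simp⟩
      · obtain ⟨u', -, h⟩ := h2 u v huv
        omega
    | succ m ih =>
      intro u v hm
      by_cases huv : u = v
      · subst huv; exact ⟨.nil, by simp⟩
      · obtain ⟨u', ha, h⟩ := h2 u v huv
        obtain ⟨p, hp⟩ := ih u' v (by omega)
        exact ⟨.cons ha p, by rw [SimpleGraph.Walk.length_cons]; omega⟩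
  have hle : ∀ u v (p : G.Walk u v), D u v ≤ p.length := by
    intro u v p
    induction p with
    | nil => rw [h0]; exact Nat.zero_le _
    | cons ha p ih =>
      rw [SimpleGraph.Walk.length_cons]
      exact (h1 _ _ _ ha).trans (by omega)
  have hc : G.Connected := ⟨fun u v => let ⟨p, _⟩ := hex _ u v le_rfl; ⟨p⟩⟩
  refine ⟨hc, fun u v => le_antisymm ?_ ?_⟩
  · obtain ⟨p, hp⟩ := hex _ u v le_rfl
    exact (G.dist_le p).trans hp
  · obtain ⟨p, hp⟩ := hc.exists_walk_length_eq_dist u v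
    exact hp ▸ hle u v p

end TreeSchreier

namespace TreeSchreier

/-! ### Summation over all pairs of words and the resulting recursions. -/

section Sums

set_option linter.unusedSectionVars false

variable {V : Type*} [DecidableEq V] [Fintype V]

/-- The sum of a function over all words of length `n`. -/
def wordSum (n : ℕ) (f : List V → ℚ) : ℚ := ∑ w : List.Vector V n, f w.toList

theorem wordSum_congr {n : ℕ} {f g : List V → ℚ} (h : ∀ u, u.length = n → f u = g u) :
    wordSum n f = wordSum n g :=
  Finset.sum_congr rfl fun w _ => h _ w.toList_length

theorem wordSum_add (n : ℕ) (f g : List V → ℚ) :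
    wordSum n (fun u => f u + g u) = wordSum n f + wordSum n g := Finset.sum_add_distrib

theorem wordSum_finsetSum {ι : Type*} (n : ℕ) (s : Finset ι) (f : ι → List V → ℚ) :
    wordSum n (fun u => ∑ i ∈ s, f i u) = ∑ i ∈ s, wordSum n (f i) := Finset.sum_comm

theorem wordSum_comm (m n : ℕ) (f : List V → List V → ℚ) :
    wordSum m (fun u => wordSum n (f u)) = wordSum n (fun w => wordSum m (fun u => f u w)) :=
  Finset.sum_comm

theorem wordSum_const_mul (n : ℕ) (c : ℚ) (f : List V → ℚ) :
    wordSum n (fun u => c * f u) = c * wordSum n f := (Finset.mul_sum _ _ _).symm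

theorem wordSum_const (n : ℕ) (c : ℚ) :
    wordSum n (fun _ : List V => c) = (Fintype.card V : ℚ) ^ n * c := by
  simp [wordSum, card_vector]

theorem wordSum_zero (f : List V → ℚ) : wordSum 0 f = f [] := by
  unfold wordSum
  rw [Fintype.sum_eq_single List.Vector.nil (fun w hw => absurd (w.eq_nil) hw)]
  rfl

theorem wordSum_succ (n : ℕ) (f : List V → ℚ) :
    wordSum (n + 1) f = ∑ z, wordSum n (fun u => f (z :: u)) := by
  unfold wordSum
  rw [← Fintype.sum_prod_type']
  refine (Fintype.sum_equiv ⟨fun p => p.1 ::ᵥ p.2, fun w => (w.head, w.tail), fun p => by simp,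
    fun w => by simp⟩ _ _ fun p => ?_).symm
  simp

/-- The copy of `z` is mapped bijectively, and all words of the other copies collapse to the word
constantly `z`. -/
theorem wordSum_restr (n : ℕ) (z : V) (f : List V → ℚ) :
    wordSum (n + 1) (fun u => f (restr z u)) = wordSum n f +
      ((Fintype.card V : ℚ) - 1) * (Fintype.card V : ℚ) ^ n * f (List.replicate n z) := by
  rw [wordSum_succ, ← Finset.add_sum_erase _ _ (Finset.mem_univ z)]
  congr 1
  · simp [restr]
  · rw [Finset.sum_congr rfl (g := fun _ => (Fintype.card V : ℚ) ^ n * f (List.replicate n z)),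
      Finset.sum_const, Finset.card_erase_of_mem (Finset.mem_univ z), Finset.card_univ,
      nsmul_eq_mul, Nat.cast_sub (Fintype.card_pos_iff.2 ⟨z⟩)]
    · push_cast
      ring
    · intro c hc
      rw [← wordSum_const]
      refine wordSum_congr fun u hu => ?_
      rw [restr, if_neg (Finset.ne_of_mem_erase hc), hu]

variable (A : Finset (V × V)) (side : V × V → V → Bool)

/-- The number of vertices on a given side of the edge `a`. -/
def sideCard (a : V × V) (s : Bool) : ℚ := (Finset.univ.filter fun z => side a z = s).card

/-- The sum of the distances of all projections to the big cycle of `a` from one of the two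
constant words. -/
def sumTo (n : ℕ) (a : V × V) (s : Bool) : ℚ :=
  wordSum n fun u => (cyc (2 ^ n) (pos side a u) (if s then 2 ^ n - 1 else 0) : ℚ)

/-- The sum of all distances between projections to the big cycle of `a`. -/
def sumBig (n : ℕ) (a : V × V) : ℚ :=
  wordSum n fun u => wordSum n fun w => (big side n a u w : ℚ)

/-- The sum of `sumTo` over the vertices that are not endpoints of `a`. -/
def sumAttached (n : ℕ) (a : V × V) : ℚ :=
  (sideCard side a false - 1) * sumTo side n a false +
    (sideCard side a true - 1) * sumTo side n a true

/-- The sum of all contributions of the cycles that are not big. -/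
def sumInner (n : ℕ) : ℚ := wordSum n fun u => wordSum n fun w => (inner A side n u w : ℚ)

/-- The sum of the contributions of the cycles that are not big to the distances from the
constant words. -/
def sumInnerTo (n : ℕ) : ℚ := ∑ z, wordSum n fun u => (inner A side n u (List.replicate n z) : ℚ)

variable {A side}

theorem sideCard_add (a : V × V) :
    sideCard side a false + sideCard side a true = Fintype.card V := by
  unfold sideCard
  rw [← Nat.cast_add, ← Finset.card_univ,
    ← Finset.card_filter_add_card_filter_not (s := Finset.univ) (fun z => side a z = false)]
  simp

theorem sum_eq_ends_add {a : V × V} (ha : a.1 ≠ a.2) (f : V → ℚ) :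
    ∑ z, f z = f a.1 + f a.2 + ∑ z with z ≠ a.1 ∧ z ≠ a.2, f z := by
  have : (Finset.univ.filter fun z => z ≠ a.1 ∧ z ≠ a.2) = (Finset.univ.erase a.1).erase a.2 := by
    ext z
    simp [and_comm]
  rw [this, add_assoc, Finset.add_sum_erase _ _ (by simp [ha.symm]),
    Finset.add_sum_erase _ _ (Finset.mem_univ _)]

theorem sum_side (a : V × V) (g : Bool → ℚ) :
    ∑ z, g (side a z) = sideCard side a false * g false + sideCard side a true * g true := by
  rw [← Finset.sum_fiberwise Finset.univ (side a), Fintype.sum_bool, add_comm]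
  unfold sideCard
  congr 1 <;>
  · rw [Finset.sum_congr rfl fun z hz => by rw [(Finset.mem_filter.1 hz).2], Finset.sum_const,
      nsmul_eq_mul]

theorem sum_side_avoid (h : EdgeSides A side) {a : V × V} (ha : a ∈ A) (g : Bool → ℚ) :
    ∑ z with z ≠ a.1 ∧ z ≠ a.2, g (side a z) =
      (sideCard side a false - 1) * g false + (sideCard side a true - 1) * g true := by
  have h1 := sum_eq_ends_add (h.ne ha) fun z => g (side a z)
  rw [sum_side, h.fst a ha, h.snd a ha] at h1
  linarith

/-- The positions `i` and `i + N` are antipodal, so every point of the cycle lies on a geodesic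
between them. -/
theorem cyc_add_antipode {N i j : ℕ} (hi : i < N) (hj : j < 2 * N) :
    cyc (2 * N) i j + cyc (2 * N) (i + N) j = N := by
  unfold cyc
  omega

/-- The words `a.1 :: u` and `a.2 :: u` are antipodal, so each such pair contributes `2 ^ n`
whatever `j` is. Any other head sends the word to an end of the cycle; the `- 1` omits the endpoint
of `a` on that side. -/
theorem wordSum_cyc_pos (h : EdgeSides A side) {a : V × V} (ha : a ∈ A) (n : ℕ) {j : ℕ}
    (hj : j < 2 ^ (n + 1)) :
    wordSum (n + 1) (fun u => (cyc (2 ^ (n + 1)) (pos side a u) j : ℚ)) =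
      (Fintype.card V : ℚ) ^ n * (2 ^ n + (sideCard side a false - 1) * cyc (2 ^ (n + 1)) 0 j +
        (sideCard side a true - 1) * cyc (2 ^ (n + 1)) (2 ^ (n + 1) - 1) j) := by
  have hne := h.ne ha
  rw [wordSum_succ, sum_eq_ends_add hne, ← wordSum_add]
  have h1 : wordSum n (fun u => (cyc (2 ^ (n + 1)) (pos side a (a.1 :: u)) j : ℚ) +
      (cyc (2 ^ (n + 1)) (pos side a (a.2 :: u)) j : ℚ)) = (Fintype.card V : ℚ) ^ n * 2 ^ n := by
    rw [← wordSum_const]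
    refine wordSum_congr fun u hu => ?_
    have hp := pos_lt (side := side) a u
    rw [hu] at hp
    rw [pos, pos, if_pos rfl, if_neg hne.symm, if_pos rfl, hu, pow_succ, mul_comm]
    rw [pow_succ, mul_comm] at hj
    exact_mod_cast cyc_add_antipode hp hj
  have h2 : ∑ z with z ≠ a.1 ∧ z ≠ a.2,
      wordSum n (fun u => (cyc (2 ^ (n + 1)) (pos side a (z :: u)) j : ℚ)) =
      ∑ z with z ≠ a.1 ∧ z ≠ a.2, (fun s : Bool => (Fintype.card V : ℚ) ^ n *
        (cyc (2 ^ (n + 1)) (if s then 2 ^ (n + 1) - 1 else 0) j : ℚ)) (side a z) := by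
    refine Finset.sum_congr rfl fun z hz => ?_
    rw [Finset.mem_filter] at hz
    simp only
    rw [← wordSum_const]
    refine wordSum_congr fun u hu => ?_
    rw [pos, if_neg hz.2.1, if_neg hz.2.2, hu]
  rw [h1, h2, sum_side_avoid h ha fun s : Bool => (Fintype.card V : ℚ) ^ n *
    (cyc (2 ^ (n + 1)) (if s then 2 ^ (n + 1) - 1 else 0) j : ℚ)]
  simp only [Bool.false_eq_true, if_false, if_true]
  ring

/-- The two ends `0` and `2 ^ (n + 1) - 1` are neighbours on the cycle, so words projecting to the
opposite end contribute 1 each. -/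
theorem sumTo_succ (h : EdgeSides A side) {a : V × V} (ha : a ∈ A) (n : ℕ) (s : Bool) :
    sumTo side (n + 1) a s = (Fintype.card V : ℚ) ^ n * (2 ^ n + (sideCard side a (!s) - 1)) := by
  have h0 : 0 < 2 ^ n := by positivity
  have h1 : cyc (2 ^ (n + 1)) 0 (2 ^ (n + 1) - 1) = 1 := by
    unfold cyc; rw [pow_succ]; omega
  unfold sumTo
  cases s
  · rw [wordSum_cyc_pos h ha n (by simp)]
    simp [cyc_self, cyc_comm _ _ 0, h1]
  · rw [wordSum_cyc_pos h ha n (by simp)]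
    simp [cyc_self, h1]

theorem sumBig_succ (h : EdgeSides A side) {a : V × V} (ha : a ∈ A) (n : ℕ) :
    sumBig side (n + 1) a = ((Fintype.card V : ℚ) ^ n) ^ 2 * (2 * (Fintype.card V - 1) * 2 ^ n +
      2 * ((sideCard side a false - 1) * (sideCard side a true - 1))) := by
  have e0 := sumTo_succ h ha n false
  have e1 := sumTo_succ h ha n true
  unfold sumTo at e0 e1
  simp only [Bool.false_eq_true, if_false, if_true, Bool.not_false, Bool.not_true] at e0 e1
  unfold sumBig big
  rw [wordSum_comm, wordSum_congr (g := fun w => (Fintype.card V : ℚ) ^ n * 2 ^ n +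
      (Fintype.card V : ℚ) ^ n * (sideCard side a false - 1) *
        (cyc (2 ^ (n + 1)) (pos side a w) 0 : ℚ) +
      (Fintype.card V : ℚ) ^ n * (sideCard side a true - 1) *
        (cyc (2 ^ (n + 1)) (pos side a w) (2 ^ (n + 1) - 1) : ℚ))]
  · rw [wordSum_add, wordSum_add, wordSum_const, wordSum_const_mul, wordSum_const_mul, e0, e1,
      ← sideCard_add (side := side) a]
    ring
  · intro w hw
    rw [wordSum_cyc_pos h ha n (by rw [← hw]; exact pos_lt a w), cyc_comm _ 0, cyc_comm _ (_ - 1)]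
    ring

theorem sumAttached_succ (h : EdgeSides A side) {a : V × V} (ha : a ∈ A) (n : ℕ) :
    sumAttached side (n + 1) a = (Fintype.card V : ℚ) ^ n * ((Fintype.card V - 2) * 2 ^ n +
      2 * ((sideCard side a false - 1) * (sideCard side a true - 1))) := by
  unfold sumAttached
  rw [sumTo_succ h ha, sumTo_succ h ha, ← sideCard_add (side := side) a]
  simp only [Bool.not_false, Bool.not_true]
  ring

theorem sum_filter_avoid (f : V → V × V → ℚ) :
    ∑ z, ∑ a ∈ A with z ≠ a.1 ∧ z ≠ a.2, f z a =
      ∑ a ∈ A, ∑ z with z ≠ a.1 ∧ z ≠ a.2, f z a := by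
  simp only [Finset.sum_filter]
  exact Finset.sum_comm

theorem wordSum_innerAvoid_replicate (h : EdgeSides A side) (n : ℕ) (z : V) :
    wordSum n (fun u => (innerAvoid A side z n u (List.replicate n z) : ℚ)) =
      wordSum n (fun u => (inner A side n u (List.replicate n z) : ℚ)) +
        ∑ a ∈ A with z ≠ a.1 ∧ z ≠ a.2, sumTo side n a (side a z) := by
  unfold innerAvoid
  push_cast
  rw [wordSum_add, wordSum_finsetSum]
  congr 1
  refine Finset.sum_congr rfl fun a ha => ?_
  unfold sumTo big
  rw [pos_replicate h (Finset.mem_filter.1 ha).1]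

/-- Exchanging the sums over `z` and `a` leaves, for each edge, the vertices that are not its
endpoints, grouped by side. This is `sumAttached`. -/
theorem sum_wordSum_innerAvoid_replicate (h : EdgeSides A side) (n : ℕ) :
    ∑ z, wordSum n (fun u => (innerAvoid A side z n u (List.replicate n z) : ℚ)) =
      sumInnerTo A side n + ∑ a ∈ A, sumAttached side n a := by
  simp only [wordSum_innerAvoid_replicate h]
  rw [Finset.sum_add_distrib, sum_filter_avoid]
  congr 1
  exact Finset.sum_congr rfl fun a ha => sum_side_avoid h ha _

theorem innerAvoid_self (z : V) (n : ℕ) (u : List V) : innerAvoid A side z n u u = 0 := by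
  simp [innerAvoid, inner_self, big, cyc_self]

theorem innerAvoid_comm (z : V) (n : ℕ) (u w : List V) :
    innerAvoid A side z n u w = innerAvoid A side z n w u := by
  unfold innerAvoid big
  rw [inner_comm]
  simp only [cyc_comm]

/-- All constant words have the same projections, so the `k` summands agree. In each copy, words
from outside project to the target itself and contribute nothing. -/
theorem sumInnerTo_succ (h : EdgeSides A side) (n : ℕ) :
    sumInnerTo A side (n + 1) =
      Fintype.card V * (sumInnerTo A side n + ∑ a ∈ A, sumAttached side n a) := by
  rw [sumInnerTo, Finset.sum_congr rfl
    (g := fun _ => sumInnerTo A side n + ∑ a ∈ A, sumAttached side n a),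
    Finset.sum_const, Finset.card_univ, nsmul_eq_mul]
  intro x _
  rw [← sum_wordSum_innerAvoid_replicate h]
  simp only [inner_succ, restr_replicate]
  push_cast
  rw [wordSum_finsetSum]
  refine Finset.sum_congr rfl fun z _ => ?_
  rw [wordSum_restr n z fun u => (innerAvoid A side z n u (List.replicate n z) : ℚ),
    innerAvoid_self]
  simp

/-- In the copy of `z`, a pair of words both inside gives the full double sum, a pair with one word
outside gives distances to the constant word (two orders, `(k - 1) * k ^ n` outside words), and a
pair outside gives 0. A big cycle of level `n` survives in the `k - 2` copies of letters off its
edge. -/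
theorem sumInner_succ (h : EdgeSides A side) (n : ℕ) :
    sumInner A side (n + 1) = Fintype.card V * sumInner A side n +
      (Fintype.card V - 2) * ∑ a ∈ A, sumBig side n a +
      2 * (Fintype.card V - 1) * (Fintype.card V : ℚ) ^ n *
        (sumInnerTo A side n + ∑ a ∈ A, sumAttached side n a) := by
  have h1 : ∀ z, wordSum (n + 1) (fun u => wordSum (n + 1) fun w =>
      (innerAvoid A side z n (restr z u) (restr z w) : ℚ)) =
      sumInner A side n + ∑ a ∈ A with z ≠ a.1 ∧ z ≠ a.2, sumBig side n a +
      2 * (Fintype.card V - 1) * (Fintype.card V : ℚ) ^ n *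
        wordSum n (fun u => (innerAvoid A side z n u (List.replicate n z) : ℚ)) := by
    intro z
    have h2 : wordSum n (fun u => wordSum n fun w => (innerAvoid A side z n u w : ℚ)) =
        sumInner A side n + ∑ a ∈ A with z ≠ a.1 ∧ z ≠ a.2, sumBig side n a := by
      unfold innerAvoid sumInner sumBig
      push_cast
      simp only [wordSum_add, wordSum_finsetSum]
    have h3 : ∀ u, wordSum (n + 1) (fun w => (innerAvoid A side z n u (restr z w) : ℚ)) =
        wordSum n (fun w => (innerAvoid A side z n u w : ℚ)) +
        ((Fintype.card V : ℚ) - 1) * (Fintype.card V : ℚ) ^ n *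
          (innerAvoid A side z n u (List.replicate n z) : ℚ) :=
      fun u => wordSum_restr n z fun w => (innerAvoid A side z n u w : ℚ)
    simp only [h3]
    rw [wordSum_restr n z (fun u => wordSum n (fun w => (innerAvoid A side z n u w : ℚ)) +
        ((Fintype.card V : ℚ) - 1) * (Fintype.card V : ℚ) ^ n *
          (innerAvoid A side z n u (List.replicate n z) : ℚ)), wordSum_add, wordSum_const_mul, h2,
      innerAvoid_self, wordSum_congr (f := fun w => (innerAvoid A side z n (List.replicate n z) w : ℚ))
        fun u _ => by rw [innerAvoid_comm]]
    push_cast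
    ring
  have hbig : ∑ z, ∑ a ∈ A with z ≠ a.1 ∧ z ≠ a.2, sumBig side n a =
      (Fintype.card V - 2) * ∑ a ∈ A, sumBig side n a := by
    rw [sum_filter_avoid fun _ a => sumBig side n a, Finset.mul_sum]
    refine Finset.sum_congr rfl fun a ha => ?_
    rw [sum_side_avoid h ha fun _ => sumBig side n a, ← sideCard_add (side := side) a]
    ring
  rw [← sum_wordSum_innerAvoid_replicate h, sumInner]
  simp only [inner_succ]
  push_cast
  simp only [wordSum_finsetSum, h1]
  rw [Finset.sum_add_distrib, Finset.sum_add_distrib, Finset.sum_const, Finset.card_univ,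
    nsmul_eq_mul, hbig, ← Finset.mul_sum]

theorem wordSum_wordDist (n : ℕ) :
    wordSum n (fun u => wordSum n fun w => (wordDist A side n u w : ℚ)) =
      sumInner A side n + ∑ a ∈ A, sumBig side n a := by
  unfold wordDist sumInner sumBig
  push_cast
  simp only [wordSum_add, wordSum_finsetSum]

theorem wordSum_wordDist_eq (h : EdgeSides A side) {k w : ℚ} (hk : (Fintype.card V : ℚ) = k)
    (hA : (A.card : ℚ) = k - 1) (hk0 : k ≠ 0) (hk1 : k - 1 ≠ 0) (hk2 : 2 * k - 1 ≠ 0)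
    (hw : ∑ a ∈ A, sideCard side a false * sideCard side a true = w) (n : ℕ) :
    wordSum (n + 1) (fun u => wordSum (n + 1) fun w => (wordDist A side (n + 1) u w : ℚ)) =
      2 * ((k - 1) ^ 2 * (2 * k ^ 2 - 2 * k - 1) / (k ^ 3 * (2 * k - 1))
          * (2 ^ (n + 1) * k ^ (2 * (n + 1)))
        - 2 * (k - 1) ^ 2 / k ^ 2 * (((n + 1 : ℕ) : ℚ) * k ^ (2 * (n + 1)))
        + 2 * (k + 1) * (k - 1) / k ^ 3 * k ^ (2 * (n + 1))
        - 2 * (k + 1) * (k - 1) / (k * (2 * k - 1)) * k ^ (n + 1)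
        + (2 / k ^ 2 * (((n + 1 : ℕ) : ℚ) * k ^ (2 * (n + 1)))
            - (k ^ 2 + 2) / (k ^ 3 * (k - 1)) * k ^ (2 * (n + 1))
            + (k + 2) / (k ^ 2 * (k - 1)) * k ^ (n + 1)) * w) := by
  -- With `p + q = k`, `(p - 1) * (q - 1) = p * q - (k - 1)`, and there are `k - 1` edges.
  have hQ : ∑ a ∈ A, (sideCard side a false - 1) * (sideCard side a true - 1) =
      w - (k - 1) ^ 2 := by
    rw [← hw, pow_two]
    nth_rewrite 1 [← hA]
    rw [← nsmul_eq_mul, ← Finset.sum_const, ← Finset.sum_sub_distrib]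
    refine Finset.sum_congr rfl fun a _ => ?_
    rw [← hk, ← sideCard_add (side := side) a]
    ring
  have hB : ∀ n, ∑ a ∈ A, sumBig side (n + 1) a =
      (k ^ n) ^ 2 * (2 * (k - 1) ^ 2 * 2 ^ n + 2 * (w - (k - 1) ^ 2)) := by
    intro n
    rw [Finset.sum_congr rfl fun a ha => sumBig_succ h ha n, ← Finset.mul_sum,
      Finset.sum_add_distrib, Finset.sum_const, ← Finset.mul_sum, hQ, nsmul_eq_mul, hA, hk]
    ring
  have hE : ∀ n, ∑ a ∈ A, sumAttached side (n + 1) a =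
      k ^ n * ((k - 1) * (k - 2) * 2 ^ n + 2 * (w - (k - 1) ^ 2)) := by
    intro n
    rw [Finset.sum_congr rfl fun a ha => sumAttached_succ h ha n, ← Finset.mul_sum,
      Finset.sum_add_distrib, Finset.sum_const, ← Finset.mul_sum, hQ, nsmul_eq_mul, hA, hk]
    ring
  have hB0 : ∀ a, sumBig side 0 a = 0 := fun a => by
    simp [sumBig, wordSum_zero, big, cyc_self]
  have hE0 : ∀ a, sumAttached side 0 a = 0 := fun a => by
    simp [sumAttached, sumTo, wordSum_zero, pos, cyc_self]
  have hJ0 : sumInnerTo A side 0 = 0 := by simp [sumInnerTo, wordSum_zero, inner]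
  have hI0 : sumInner A side 0 = 0 := by simp [sumInner, wordSum_zero, inner]
  have hJ : ∀ n, sumInnerTo A side (n + 1) =
      k ^ n * ((k - 1) * (k - 2) * (2 ^ n - 1) + 2 * (w - (k - 1) ^ 2) * n) := by
    intro n
    induction n with
    | zero => simp [sumInnerTo_succ h, hJ0, hE0]
    | succ n ih =>
      rw [sumInnerTo_succ h, ih, hE, hk]
      push_cast
      ring
  rw [wordSum_wordDist, hB]
  induction n with
  | zero =>
    rw [sumInner_succ h, hI0, hJ0]
    simp only [hB0, hE0, Finset.sum_const_zero]
    push_cast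
    field_simp
    ring
  | succ n ih =>
    -- The induction hypothesis is about the total; solved for `sumInner`, it can be fed into the
    -- recursion.
    rw [← eq_sub_iff_add_eq] at ih
    rw [sumInner_succ h, ih, hJ, hE, hB, hk]
    have e1 : k ^ (2 * (n + 1)) = (k ^ n) ^ 2 * k ^ 2 := by ring
    have e2 : k ^ (2 * (n + 1 + 1)) = (k ^ n) ^ 2 * k ^ 4 := by ring
    rw [e1, e2, pow_succ k (n + 1), pow_succ k n, pow_succ 2 (n + 1), pow_succ 2 n]
    push_cast
    generalize k ^ n = Y
    generalize (2 : ℚ) ^ n = X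
    generalize (n : ℚ) = m
    -- Naming `2 * k - 1` keeps this denominator a single factor while fractions are cleared.
    obtain ⟨d, hd⟩ : ∃ d, 2 * k - 1 = d := ⟨_, rfl⟩
    rw [hd] at hk2 ⊢
    field_simp
    rw [← hd]
    ring

end Sums

end TreeSchreier

namespace TreeSchreier

/-! ### Moves on reversed words compared with the automaton, and their inverses. -/

section Words

set_option linter.unusedSectionVars false

variable {V : Type*} [DecidableEq V]

/-- The appended letter is the first letter of the original word, so this is the defining recursion
of the automaton. -/
theorem step_concat {x y : V} (u : List V) (z : V) :
    step x y (u ++ [z]) = if z = x then step x y u ++ [y] else u ++ [swapLetter x y z] := by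
  induction u with
  | nil =>
    simp only [List.nil_append, step, List.length_nil, List.replicate_zero, if_true]
    split_ifs with h <;> simp [swapLetter, h]
  | cons c u ih =>
    have hiff : u ++ [z] = List.replicate (u ++ [z]).length x ↔
        u = List.replicate u.length x ∧ z = x := by
      rw [List.length_append, List.length_singleton, List.replicate_succ']
      constructor
      · intro h
        have := List.append_inj h (by simp)
        exact ⟨this.1, by simpa using this.2⟩
      · rintro ⟨h, rfl⟩
        rw [← h]
    rw [List.cons_append, step, step]
    by_cases hz : z = x
    · by_cases hu : u = List.replicate u.length x
      · rw [if_pos (hiff.2 ⟨hu, hz⟩), if_pos hz, if_pos hu, List.length_append,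
          List.length_singleton, List.replicate_succ', List.cons_append]
      · rw [if_neg fun h => hu (hiff.1 h).1, if_pos hz, if_neg hu, ih, if_pos hz, List.cons_append]
    · rw [if_neg fun h => hz (hiff.1 h).2, if_neg hz, ih, if_neg hz, List.cons_append]

theorem step_step {x y : V} (hxy : x ≠ y) (u : List V) : step y x (step x y u) = u := by
  induction u with
  | nil => rfl
  | cons z u ih =>
    by_cases hu : u = List.replicate u.length x
    · rw [step, if_pos hu, step, if_pos (by simp), List.length_replicate, ← hu]
      congr 1
      unfold swapLetter
      by_cases h1 : z = x
      · rw [if_pos h1, if_pos rfl, h1]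
      · by_cases h2 : z = y
        · rw [if_neg h1, if_pos h2, if_neg hxy, if_pos rfl, h2]
        · rw [if_neg h1, if_neg h2, if_neg h2, if_neg h1]
    · rw [step, if_neg hu, step, if_neg, ih]
      intro h
      rw [h, length_step, step_replicate] at ih
      exact hu ih.symm

variable [Fintype V]

theorem sum_reverse (n : ℕ) (f : List V → ℚ) :
    ∑ w : List.Vector V n, f w.toList.reverse = wordSum n f :=
  Fintype.sum_equiv (Function.Involutive.toPerm List.Vector.reverse fun _ =>
    List.Vector.reverse_reverse) _ _ fun w =>
    congrArg f (List.Vector.toList_reverse (v := w)).symm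

end Words

/-! ### The two sides of an edge of a tree, distances and the Wiener index. -/

section Tree

variable {V : Type*}

open Classical in
/-- Whether a vertex is disconnected from the first endpoint of an edge when the edge is
removed. -/
noncomputable def farSide (G : SimpleGraph V) (a : V × V) (z : V) : Bool :=
  decide ¬ (G.deleteEdges {s(a.1, a.2)}).Reachable a.1 z

variable {G : SimpleGraph V}

theorem farSide_eq_of_adj {a : V × V} {x y : V} (h : G.Adj x y) (hne : s(x, y) ≠ s(a.1, a.2)) :
    farSide G a x = farSide G a y := by
  have hd : (G.deleteEdges {s(a.1, a.2)}).Adj x y := by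
    rw [SimpleGraph.deleteEdges_adj]
    exact ⟨h, hne⟩
  unfold farSide
  rw [decide_eq_decide, not_iff_not]
  exact ⟨fun h' => h'.trans hd.reachable, fun h' => h'.trans hd.symm.reachable⟩

theorem farSide_fst (a : V × V) : farSide G a a.1 = false := by
  simp [farSide]

theorem farSide_snd (hG : G.IsAcyclic) {a : V × V} (h : G.Adj a.1 a.2) :
    farSide G a a.2 = true := by
  have := SimpleGraph.isAcyclic_iff_forall_adj_isBridge.1 hG h
  rw [SimpleGraph.isBridge_iff] at this
  simpa only [farSide, decide_eq_true_eq] using this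

/-- The first edge of the path from `x` to `z` works, since the rest of the path avoids it and it is
a bridge. Both orders are needed because the orientation of that edge is not known. -/
theorem exists_adj_farSide_ne (hG : G.IsTree) {x z : V} (hxz : x ≠ z) :
    ∃ y, G.Adj x y ∧ (farSide G (x, y) x ≠ farSide G (x, y) z) ∧
      (farSide G (y, x) x ≠ farSide G (y, x) z) := by
  classical
  obtain ⟨p, hp⟩ := (hG.1.preconnected x z).exists_isPath
  cases p with
  | nil => exact absurd rfl hxz
  | @cons _ y _ hxy q =>
    rw [SimpleGraph.Walk.cons_isPath_iff] at hp
    have hr : (G.deleteEdges {s(x, y)}).Reachable y z :=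
      ⟨q.toDeleteEdge s(x, y) fun h => hp.2 (q.fst_mem_support_of_mem_edges h)⟩
    refine ⟨y, hxy, ?_, ?_⟩
    · have h2 := farSide_snd hG.2 (a := (x, y)) hxy
      rw [farSide_fst (x, y)]
      unfold farSide at h2 ⊢
      simp only [decide_eq_true_eq] at h2
      intro h
      rw [eq_comm, decide_eq_false_iff_not, not_not] at h
      exact h2 (h.trans hr.symm)
    · have h2 := farSide_snd hG.2 (a := (y, x)) hxy.symm
      have h3 : farSide G (y, x) z = false := by
        unfold farSide
        simp only [decide_eq_false_iff_not, not_not]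
        rwa [Sym2.eq_swap] at hr
      simp only at h2
      rw [h2, h3]
      simp

variable (o : GraphOrientation G)

theorem mk_ne_of_mem_arcs {a b : V × V} (ha : a ∈ o.arcs) (hb : b ∈ o.arcs) (hab : a ≠ b) :
    s(b.1, b.2) ≠ s(a.1, a.2) := by
  intro h
  rw [Sym2.eq_iff] at h
  rcases h with h | h
  · exact hab (Prod.ext h.1.symm h.2.symm)
  · have hx := o.mem_of_adj (o.adj_of_mem ha)
    have : (a.2, a.1) ∈ o.arcs := by rw [← h.1, ← h.2]; exact hb
    rcases hx with hx | hx
    · exact hx.2 this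
    · exact hx.2 ha

theorem exists_mem_arcs {x y : V} (h : G.Adj x y) : ∃ a ∈ o.arcs, Ends a x y := by
  rcases o.mem_of_adj h with h | h
  · exact ⟨_, h.1, Or.inl ⟨rfl, rfl⟩⟩
  · exact ⟨_, h.1, Or.inr ⟨rfl, rfl⟩⟩

variable [Fintype V]

/-- The set of oriented edges as a finset. -/
noncomputable def arcFinset : Finset (V × V) := (Set.toFinite o.arcs).toFinset

variable {o}

theorem mem_arcFinset {a : V × V} : a ∈ arcFinset o ↔ a ∈ o.arcs := by simp [arcFinset]

theorem edgeSides_farSide (hG : G.IsTree) : EdgeSides (arcFinset o) (farSide G) where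
  fst a _ := farSide_fst a
  snd a ha := farSide_snd hG.2 (o.adj_of_mem (mem_arcFinset.1 ha))
  other a ha b hb hab := by
    rw [mem_arcFinset] at ha hb
    exact farSide_eq_of_adj (o.adj_of_mem hb) (mk_ne_of_mem_arcs o ha hb hab)
  sep x z hxz := by
    obtain ⟨y, hxy, h1, h2⟩ := exists_adj_farSide_ne hG hxz
    obtain ⟨a, ha, hE⟩ := exists_mem_arcs o hxy
    refine ⟨a, mem_arcFinset.2 ha, hE.imp (fun h => h.1.symm) (fun h => h.1.symm), ?_⟩
    rcases hE with ⟨rfl, rfl⟩ | ⟨rfl, rfl⟩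
    · exact h1
    · exact h2

theorem card_arcFinset (hG : G.IsTree) : (arcFinset o).card + 1 = Fintype.card V := by
  classical
  rw [← hG.card_edgeFinset]
  congr 1
  refine Finset.card_bij (fun a _ => s(a.1, a.2)) ?_ ?_ ?_
  · intro a ha
    rw [SimpleGraph.mem_edgeFinset]
    exact o.adj_of_mem (mem_arcFinset.1 ha)
  · intro a ha b hb h
    by_contra hab
    exact mk_ne_of_mem_arcs o (mem_arcFinset.1 ha) (mem_arcFinset.1 hb) hab h.symm
  · intro e he
    induction e with
    | _ x y =>
      rw [SimpleGraph.mem_edgeFinset] at he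
      obtain ⟨a, ha, hE⟩ := exists_mem_arcs o he
      refine ⟨a, mem_arcFinset.2 ha, ?_⟩
      rcases hE with ⟨rfl, rfl⟩ | ⟨rfl, rfl⟩
      · rfl
      · exact Sym2.eq_swap

-- A distance in a tree counts the separating edges. This count meets the same criterion as
-- `wordDist`: crossing an edge changes only the term of that edge.
variable (o) in
theorem dist_eq_sum_farSide (hG : G.IsTree) (u v : V) :
    G.dist u v = ∑ a ∈ arcFinset o, if farSide G a u = farSide G a v then 0 else 1 := by
  classical
  have := hG.1.nonempty
  have hS := edgeSides_farSide (o := o) hG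
  have hmove : ∀ a ∈ arcFinset o, ∀ u u' v, Ends a u u' →
      (∑ b ∈ arcFinset o, if farSide G b u = farSide G b v then 0 else 1) +
        (if farSide G a u' = farSide G a v then 0 else 1) =
      (∑ b ∈ arcFinset o, if farSide G b u' = farSide G b v then 0 else 1) +
        (if farSide G a u = farSide G a v then 0 else 1) := by
    intro a ha u u' v hE
    rw [← Finset.add_sum_erase _ _ ha, ← Finset.add_sum_erase (arcFinset o)
      (fun b => if farSide G b u' = farSide G b v then 0 else 1) ha]
    have : ∀ b ∈ (arcFinset o).erase a, (if farSide G b u = farSide G b v then 0 else 1) =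
        if farSide G b u' = farSide G b v then 0 else 1 := by
      intro b hb
      rw [Finset.mem_erase] at hb
      rw [hS.other' ha hb.2 hb.1 hE]
    rw [Finset.sum_congr rfl this]
    ring
  refine (connected_and_dist_eq G
    (fun u v => ∑ a ∈ arcFinset o, if farSide G a u = farSide G a v then 0 else 1)
    (fun v => by simp) ?_ ?_).2 u v
  · intro u u' v hu
    obtain ⟨a, ha, hE⟩ := exists_mem_arcs o hu
    have := hmove a (mem_arcFinset.2 ha) u u' v hE
    split_ifs at this <;> omega
  · intro u v huv
    obtain ⟨a, ha, hu, hs⟩ := hS.sep u v huv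
    have hadj := o.adj_of_mem (mem_arcFinset.1 ha)
    have key : ∀ u', Ends a u u' → farSide G a u' = farSide G a v →
        (∑ b ∈ arcFinset o, if farSide G b u' = farSide G b v then 0 else 1) <
        ∑ b ∈ arcFinset o, if farSide G b u = farSide G b v then 0 else 1 := by
      intro u' hE h'
      have := hmove a ha u u' v hE
      rw [if_pos h', if_neg hs] at this
      omega
    have h1 := hS.fst a ha
    have h2 := hS.snd a ha
    rcases hu with rfl | rfl
    · refine ⟨a.2, hadj, key _ (Or.inl ⟨rfl, rfl⟩) ?_⟩
      rw [h1] at hs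
      rw [h2]
      exact (Bool.eq_true_of_not_eq_false (Ne.symm hs)).symm
    · refine ⟨a.1, hadj.symm, key _ (Or.inr ⟨rfl, rfl⟩) ?_⟩
      rw [h2] at hs
      rw [h1]
      exact (Bool.eq_false_of_not_eq_true (Ne.symm hs)).symm

-- Each edge is counted once for every pair of vertices it separates; the factor `1 / 2` compensates
-- for the ordered pairs.
variable (o) in
theorem wienerIndex_eq_sum_sideCard [DecidableEq V] (hG : G.IsTree) : wienerIndex G =
    ∑ a ∈ arcFinset o, sideCard (farSide G) a false * sideCard (farSide G) a true := by
  unfold wienerIndex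
  simp only [dist_eq_sum_farSide o hG]
  push_cast
  have h1 : ∀ u, ∑ v, ∑ a ∈ arcFinset o, (if farSide G a u = farSide G a v then (0 : ℚ) else 1) =
      ∑ a ∈ arcFinset o, ∑ v, (if farSide G a u = farSide G a v then (0 : ℚ) else 1) :=
    fun u => Finset.sum_comm
  simp only [h1]
  rw [Finset.sum_comm, Finset.mul_sum]
  refine Finset.sum_congr rfl fun a _ => ?_
  have h2 : ∀ u, ∑ v, (if farSide G a u = farSide G a v then (0 : ℚ) else 1) = _ :=
    fun u => sum_side (side := farSide G) a fun s => if farSide G a u = s then (0 : ℚ) else 1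
  simp only [h2]
  rw [sum_side (side := farSide G) a fun s => sideCard (farSide G) a false *
    (if s = false then (0 : ℚ) else 1) + sideCard (farSide G) a true * if s = true then 0 else 1]
  simp
  ring

end Tree

/-! ### Identification of the Schreier graph and its distance. -/

section Schreier

variable {V : Type*} [DecidableEq V] {G : SimpleGraph V} (o : GraphOrientation G)

theorem act_none (w : List V) : (graphAutomaton o).act none w = w := by
  induction w with
  | nil => rfl
  | cons z w ih => exact congrArg (z :: ·) ih

theorem reverse_act_some (e : o.arcs) (w : List V) :
    ((graphAutomaton o).act (some e) w).reverse = step e.1.1 e.1.2 w.reverse := by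
  induction w with
  | nil => rfl
  | cons z w ih =>
    rw [List.reverse_cons, step_concat, Transducer.act, List.reverse_cons]
    by_cases hz : z = e.1.1
    · simp [graphAutomaton, hz] at ih ⊢
      rw [ih]
    · simp only [graphAutomaton, if_neg hz]
      have := act_none o w
      simp only [graphAutomaton] at this
      rw [this]
      simp [swapLetter, hz]

/-- An undirected edge may be traversed against its label. By `step_step` this is the move of the
reversed arc, hence the two orders in `Ends`. -/
theorem simpleSchreierGraph_adj {n : ℕ} {u v : List.Vector V n} :
    ((graphAutomaton o).simpleSchreierGraph n).Adj u v ↔ u ≠ v ∧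
      ∃ a ∈ o.arcs, ∃ x y, Ends a x y ∧ v.toList.reverse = step x y u.toList.reverse := by
  have hne : ∀ e : o.arcs, e.1.1 ≠ e.1.2 := fun e => (o.adj_of_mem e.2).ne
  have hact : ∀ (e : o.arcs) (u v : List.Vector V n),
      v = (graphAutomaton o).actWord n (some e) u ↔
        v.toList.reverse = step e.1.1 e.1.2 u.toList.reverse := by
    intro e u v
    rw [← reverse_act_some o e, List.reverse_inj]
    exact Subtype.ext_iff
  have hid : ∀ u : List.Vector V n, (graphAutomaton o).actWord n none u = u :=
    fun u => Subtype.ext (act_none o _)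
  rw [Transducer.simpleSchreierGraph, SimpleGraph.fromRel_adj]
  refine and_congr_right fun huv => ?_
  have hG : ∀ u v : List.Vector V n, u ≠ v → (((graphAutomaton o).schreierGraph n).Adj u v ↔
      ∃ e : o.arcs, v = (graphAutomaton o).actWord n (some e) u ∨
        u = (graphAutomaton o).actWord n (some e) v) := by
    intro u v huv
    constructor
    · rintro ⟨⟨q, w⟩, ⟨h1, h2⟩ | ⟨h1, h2⟩⟩ <;> simp only at h1 h2 <;> subst h1 <;> cases q with
      | none => rw [hid] at h2; exact absurd h2 (by tauto)
      | some e => exact ⟨e, by tauto⟩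
    · rintro ⟨e, h | h⟩
      · exact ⟨(some e, u), Or.inl ⟨rfl, h⟩⟩
      · exact ⟨(some e, v), Or.inr ⟨rfl, h⟩⟩
  rw [hG u v huv, hG v u huv.symm]
  simp only [hact]
  constructor
  · have : (∃ e : o.arcs, v.toList.reverse = step e.1.1 e.1.2 u.toList.reverse ∨
        u.toList.reverse = step e.1.1 e.1.2 v.toList.reverse) →
        ∃ a ∈ o.arcs, ∃ x y, Ends a x y ∧ v.toList.reverse = step x y u.toList.reverse := by
      rintro ⟨e, h | h⟩
      · exact ⟨e.1, e.2, _, _, Or.inl ⟨rfl, rfl⟩, h⟩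
      · exact ⟨e.1, e.2, _, _, Or.inr ⟨rfl, rfl⟩, by rw [h, step_step (hne e)]⟩
    rintro (h | ⟨e, h⟩)
    · exact this h
    · exact this ⟨e, h.symm⟩
  · rintro ⟨a, ha, x, y, ⟨rfl, rfl⟩ | ⟨rfl, rfl⟩, h⟩
    · exact Or.inl ⟨⟨a, ha⟩, Or.inl h⟩
    · exact Or.inl ⟨⟨a, ha⟩, Or.inr (by rw [h, step_step (hne ⟨a, ha⟩).symm])⟩

theorem simpleSchreierGraph_connected_and_dist [Fintype V] (hG : G.IsTree) (n : ℕ) :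
    ((graphAutomaton o).simpleSchreierGraph n).Connected ∧
    ∀ u v, ((graphAutomaton o).simpleSchreierGraph n).dist u v =
      wordDist (arcFinset o) (farSide G) n u.toList.reverse v.toList.reverse := by
  have hS := edgeSides_farSide (o := o) hG
  have : Nonempty (List.Vector V n) := ⟨List.Vector.replicate n hG.1.nonempty.some⟩
  refine connected_and_dist_eq _ _ (fun v => wordDist_self _ _) ?_ ?_
  · intro u u' v hu
    obtain ⟨-, a, ha, x, y, hE, h⟩ := (simpleSchreierGraph_adj o).1 hu
    -- The bound in `wordDist_step_le` is for the moved word, so `u` is written as a move of `u'`.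
    have hE' : Ends a y x := hE.symm.imp And.symm And.symm
    have e : u.toList.reverse = step y x u'.toList.reverse := by
      rw [h, step_step (hE.ne hS (mem_arcFinset.2 ha))]
    rw [e]
    exact wordDist_step_le hS (mem_arcFinset.2 ha) hE' (by simp) (by simp)
  · intro u v huv
    obtain ⟨a, ha, hs⟩ := exists_sees hS (n := n) (u := u.toList.reverse) (w := v.toList.reverse)
      (by simp) (by simp) fun h =>
        huv (List.Vector.toList_injective (List.reverse_injective h))
    obtain ⟨x, y, hE, hlt⟩ := hs.exists_step hS ha (n := n) (by simp) (by simp)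
    let u' : List.Vector V n := ⟨(step x y u.toList.reverse).reverse, by simp⟩
    have hu' : u'.toList.reverse = step x y u.toList.reverse := List.reverse_reverse _
    rw [← hu'] at hlt
    refine ⟨u', (simpleSchreierGraph_adj o).2 ⟨?_, a, mem_arcFinset.1 ha, x, y, hE, hu'⟩, hlt⟩
    intro h
    rw [← h] at hlt
    exact lt_irrefl _ hlt

end Schreier

theorem wienerIndex_of_subsingleton {W : Type*} [Fintype W] [Subsingleton W]
    (H : SimpleGraph W) : wienerIndex H = 0 := by
  unfold wienerIndex
  rw [Finset.sum_eq_zero, mul_zero]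
  intro u _
  refine Finset.sum_eq_zero fun v _ => ?_
  rw [Subsingleton.elim v u, SimpleGraph.dist_self, Nat.cast_zero]

end TreeSchreier

theorem mainTheorem1 {V : Type*} [Fintype V] [DecidableEq V] (G : SimpleGraph V) (hG : G.IsTree)
    (o : GraphOrientation G) (k : ℕ) (hk : Fintype.card V = k) (n : ℕ) (hn : 1 ≤ n) :
    ((graphAutomaton o).simpleSchreierGraph n).Connected ∧
    wienerIndex ((graphAutomaton o).simpleSchreierGraph n) =
      ((k : ℚ) - 1) ^ 2 * (2 * (k : ℚ) ^ 2 - 2 * k - 1) / ((k : ℚ) ^ 3 * (2 * k - 1))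
          * (2 ^ n * (k : ℚ) ^ (2 * n))
        - 2 * ((k : ℚ) - 1) ^ 2 / (k : ℚ) ^ 2 * (n * (k : ℚ) ^ (2 * n))
        + 2 * ((k : ℚ) + 1) * ((k : ℚ) - 1) / (k : ℚ) ^ 3 * (k : ℚ) ^ (2 * n)
        - 2 * ((k : ℚ) + 1) * ((k : ℚ) - 1) / ((k : ℚ) * (2 * k - 1)) * (k : ℚ) ^ n
        + (2 / (k : ℚ) ^ 2 * (n * (k : ℚ) ^ (2 * n))
            - ((k : ℚ) ^ 2 + 2) / ((k : ℚ) ^ 3 * ((k : ℚ) - 1)) * (k : ℚ) ^ (2 * n)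
            + ((k : ℚ) + 2) / ((k : ℚ) ^ 2 * ((k : ℚ) - 1)) * (k : ℚ) ^ n) * wienerIndex G := by
  obtain ⟨hc, hd⟩ := TreeSchreier.simpleSchreierGraph_connected_and_dist o hG n
  refine ⟨hc, ?_⟩
  have := hG.1.nonempty
  have hpos : 1 ≤ k := hk ▸ Fintype.card_pos
  rcases hpos.eq_or_lt with h1 | h1
  -- For `k = 1` there is a single word, both Wiener indices vanish, and division by `k - 1 = 0` is
  -- harmless because it yields 0.
  · have : Subsingleton V := Fintype.card_le_one_iff_subsingleton.1 (by omega)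
    have : Subsingleton (List.Vector V n) := by
      rw [← Fintype.card_le_one_iff_subsingleton, card_vector, hk, ← h1, one_pow]
    rw [TreeSchreier.wienerIndex_of_subsingleton, TreeSchreier.wienerIndex_of_subsingleton, ← h1]
    simp
  · obtain ⟨m, rfl⟩ := Nat.exists_eq_add_of_le' hn
    have hk' : (2 : ℚ) ≤ k := by exact_mod_cast h1
    have hcard := TreeSchreier.card_arcFinset (o := o) hG
    have hA : ((TreeSchreier.arcFinset o).card : ℚ) = k - 1 := by
      rw [eq_sub_iff_add_eq, ← hk, ← hcard]
      push_cast
      rfl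
    have key := TreeSchreier.wordSum_wordDist_eq (TreeSchreier.edgeSides_farSide (o := o) hG)
      (congrArg Nat.cast hk) hA (by positivity) (by linarith) (by linarith)
      (TreeSchreier.wienerIndex_eq_sum_sideCard o hG).symm m
    rw [wienerIndex]
    simp only [hd]
    have hsum : ∀ u : List V, ∑ v : List.Vector V (m + 1), (TreeSchreier.wordDist
        (TreeSchreier.arcFinset o) (TreeSchreier.farSide G) (m + 1) u v.toList.reverse : ℚ) =
        TreeSchreier.wordSum (m + 1) fun w => (TreeSchreier.wordDist
          (TreeSchreier.arcFinset o) (TreeSchreier.farSide G) (m + 1) u w : ℚ) :=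
      fun u => TreeSchreier.sum_reverse (m + 1) fun w => (TreeSchreier.wordDist
        (TreeSchreier.arcFinset o) (TreeSchreier.farSide G) (m + 1) u w : ℚ)
    simp only [hsum]
    rw [TreeSchreier.sum_reverse (m + 1) fun u => TreeSchreier.wordSum (m + 1) fun w =>
      ((TreeSchreier.wordDist (TreeSchreier.arcFinset o) (TreeSchreier.farSide G) (m + 1) u w : ℕ)
        : ℚ), key]
    ring
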